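/- Let $g(z)=\sum_{n\ge 0} a_n z^n$ be a power series with non-negative coefficients, non-constant, with radius of convergence $R\in(0,\infty]$. For $t\in(0,R)$ let $X_t$ be the random variable with $\mathbf{P}(X_t=n)=a_nt^n/g(t)$, $n\ge 0$ (its Khinchin family), and let $m_g(t)$ and $\sigma_g^2(t)$ be its mean and variance. For any other such power series $f$, the family and the functions $m_f,\sigma_f$ are defined in the same way. Call $g$ a clan if $\lim_{t\uparrow R}\sigma_g(t)/m_g(t)=0$. A non-constant power series $f$ with non-negative coefficients, positive constant coefficient and radius of convergence $R>0$, with Khinchin family $(X_t)$, is called Gaussian if $\breve X_t=(X_t-m_f(t))/\sigma_f(t)$ converges in distribution to the standard normal law as $t\uparrow R$; its fulcrum is $F(s)=\ln f(e^s)$, $s<\ln R$. Theorem. Assume that $g$ is a clan and that $\lim_{t\uparrow R}g(t)=+\infty$. Let $f=e^g$ (as a power series, $f=\sum_{k\ge0}g^k/k!$). Then $f$ has radius of convergence $R$ and $f(t)=e^{g(t)}$ for all real $t$ with $|t|<R$. Let $F$ be the fulcrum of $f$, $(X_t)$ the Khinchin family of $f$ and $\breve X_t$ its normalization. Then $$\lim_{s\uparrow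 \ln R}\frac{F^{(k)}(s)}{F''(s)^{k/2}}=0\qquad\text{for every integer } k\ge 3;$$ for every integer $j\ge 0$ the moments $\mathbf{E}(\breve X_t^{\,j})$, $t\in(0,R)$, are finite and $$\lim_{t\uparrow R}\mathbf{E}(\breve X_t^{\,j})=\mathbf{E}(Z^j),$$ where $Z$ is a standard normal random variable; and $f$ is Gaussian. In particular, for every $k\ge 1$ the $k$-th iterate $\exp\circ\cdots\circ\exp$ is an entire function whose power series at $0$ (which is obtained from $z$ by applying $g\mapsto e^g$ $k$ times) is Gaussian. -/

import Mathlib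

open Filter Topology MeasureTheory ProbabilityTheory

noncomputable section

namespace Khinchin

/-- The radius of convergence `R ∈ [0, ∞]` of a power series `∑ aₙ zⁿ`. -/
def radius (f : PowerSeries ℝ) : ENNReal :=
  (FormalMultilinearSeries.ofScalars ℝ (fun n => PowerSeries.coeff n f)).radius

/-- The sum `f(t) = ∑ aₙ tⁿ` (meaningful for `|t| < R`). -/
def eval (f : PowerSeries ℝ) (t : ℝ) : ℝ :=
  ∑' n : ℕ, PowerSeries.coeff n f * t ^ n

/-- `f` is a non-constant power series with non-negative coefficients and positive radius of
convergence. -/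
structure IsNonnegSeries (f : PowerSeries ℝ) : Prop where
  radius_pos : 0 < radius f
  coeff_nonneg : ∀ n, 0 ≤ PowerSeries.coeff n f
  nonconstant : ∃ n, 1 ≤ n ∧ PowerSeries.coeff n f ≠ 0

/-- The class `𝒦`: in addition, the constant coefficient is positive. -/
structure InClassK (f : PowerSeries ℝ) : Prop extends IsNonnegSeries f where
  constantCoeff_pos : 0 < PowerSeries.coeff 0 f

/-- The open interval `(0, R)`, where `R` is the radius of convergence of `f`. -/
def interval (f : PowerSeries ℝ) : Set ℝ :=
  {t | 0 < t ∧ ENNReal.ofReal t < radius f}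

/-- The filter `x ↑ b` on the real line, for `b ∈ [-∞, ∞]`: for real `b` it is the filter of left
neighbourhoods of `b`, and for `b = ∞` it is `atTop`. -/
def upTo (b : EReal) : Filter ℝ :=
  comap (fun x : ℝ => (x : EReal)) (𝓝[<] b)

/-- The law of `X_t`: the measure on `ℕ` with mass function `n ↦ aₙ tⁿ / f(t)`. -/
def law (f : PowerSeries ℝ) (t : ℝ) : Measure ℕ :=
  Measure.sum fun n : ℕ =>
    ENNReal.ofReal (PowerSeries.coeff n f * t ^ n / eval f t) • Measure.dirac n

/-- The mean `m_f(t) = E(X_t)`. -/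
def mean (f : PowerSeries ℝ) (t : ℝ) : ℝ :=
  ∫ n : ℕ, (n : ℝ) ∂(law f t)

/-- The standard deviation `σ_f(t) = √V(X_t)`. -/
def stdDev (f : PowerSeries ℝ) (t : ℝ) : ℝ :=
  √(variance (fun n : ℕ => (n : ℝ)) (law f t))

/-- The normalization of `X_t`, namely `(X_t - E(X_t)) / √V(X_t)`, as a random variable on the
probability space `(ℕ, law f t)`. -/
def normalized (f : PowerSeries ℝ) (t : ℝ) (n : ℕ) : ℝ :=
  ((n : ℝ) - mean f t) / stdDev f t

/-- `f` is a clan: `σ_f(t) / m_f(t) → 0` as `t ↑ R`. -/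
def IsClan (f : PowerSeries ℝ) : Prop :=
  Tendsto (fun t => stdDev f t / mean f t) (upTo (radius f : EReal)) (𝓝 0)

/-- The fulcrum `F(s) = log f(eˢ)`, for real `s < log R`. -/
def fulcrum (f : PowerSeries ℝ) (s : ℝ) : ℝ :=
  Real.log (eval f (Real.exp s))

/-- The power series `e^g = ∑ₖ gᵏ / k!`, coefficient by coefficient. -/
def expSeries (g : PowerSeries ℝ) : PowerSeries ℝ :=
  PowerSeries.mk fun n => ∑' k : ℕ, PowerSeries.coeff n (g ^ k) / (k.factorial : ℝ)

theorem summable_of_mem_interval {f : PowerSeries ℝ} {t : ℝ} (ht : t ∈ interval f) :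
    Summable fun n : ℕ => PowerSeries.coeff n f * t ^ n := by
  obtain ⟨h0, h1⟩ := ht
  have h := (FormalMultilinearSeries.ofScalars ℝ
    (fun n => PowerSeries.coeff n f)).summable_norm_mul_pow (r := t.toNNReal) h1
  refine Summable.of_norm (h.congr fun n => ?_)
  rw [FormalMultilinearSeries.ofScalars_norm, norm_mul, norm_pow, Real.coe_toNNReal _ h0.le,
    Real.norm_of_nonneg h0.le]

theorem eval_pos {f : PowerSeries ℝ} (hf : IsNonnegSeries f) {t : ℝ} (ht : t ∈ interval f) :
    0 < eval f t := by
  obtain ⟨n, -, hn⟩ := hf.nonconstant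
  have h0 := ht.1
  exact (summable_of_mem_interval ht).tsum_pos
    (fun k => mul_nonneg (hf.coeff_nonneg k) (pow_nonneg h0.le k)) n
    (mul_pos (lt_of_le_of_ne (hf.coeff_nonneg n) hn.symm) (pow_pos h0 n))

theorem isProbabilityMeasure_law {f : PowerSeries ℝ} (hf : IsNonnegSeries f) {t : ℝ}
    (ht : t ∈ interval f) : IsProbabilityMeasure (law f t) := by
  have hpos := eval_pos hf ht
  have h0 := ht.1
  constructor
  rw [law, Measure.sum_apply _ MeasurableSet.univ]
  simp only [Measure.smul_apply, measure_univ, smul_eq_mul, mul_one]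
  rw [← ENNReal.ofReal_tsum_of_nonneg
    (fun n => div_nonneg (mul_nonneg (hf.coeff_nonneg n) (pow_nonneg h0.le n)) hpos.le)
    ((summable_of_mem_interval ht).div_const _), tsum_div_const]
  change ENNReal.ofReal (eval f t / eval f t) = 1
  rw [div_self hpos.ne', ENNReal.ofReal_one]

/-- `f` is Gaussian: `f ∈ 𝒦` and the normalization of `X_t` converges in distribution to the
standard normal law as `t ↑ R`. -/
def IsGaussian (f : PowerSeries ℝ) : Prop :=
  ∃ hf : InClassK f,
    haveI : ∀ t : interval f, IsProbabilityMeasure (law f t) :=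
      fun t => isProbabilityMeasure_law hf.toIsNonnegSeries t.2
    TendstoInDistribution (fun (t : interval f) => normalized f t)
      (comap Subtype.val (upTo (radius f : EReal))) (id : ℝ → ℝ)
      (fun t : interval f => law f t) (gaussianReal 0 1)

end Khinchin

end

/-!
Write `t = eˢ` and `G s = g (eˢ)`. The fulcrum of `f = e^g` is `G` itself, so its derivatives are
the power moments `∑ nᵏ aₙ tⁿ` of `g`, and `X_t` has mean `G'` and variance `G''`.

The clan hypothesis controls all these moments at once. Let `m` and `σ²` be the mean and the
variance of the Khinchin family of `g`, as functions of `s`. Then `m' = σ²`, hence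
`(1 / m)' = -(σ / m)²` tends to `0`. So `m` at most doubles between `s` and `s + 1 / m`, and
since `m = (log g)'`, the value of `g` increases at most by the factor `e²` over that step
(`fulcrum_le_add_two`). As `g` tends to infinity, the step does not leave the domain
(`eventually_eval_mul_exp_le`). In other words `∑ aₙ tⁿ e^{n / m} ≤ e² g (t)`.

* From `xᵏ ≤ k! eˣ` with `x = n / m` one gets `G⁽ᵏ⁾ ≤ k! e² mᵏ g`, while Cauchy–Schwarz gives
  `G'' ≥ m² g`; so `G⁽ᵏ⁾ / G''^{k/2} = O(g^{1 - k/2})` (`tendsto_powerMoment_div_rpow`).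
* With `σ_f² = G''`, the moment generating function of the normalized variable at a complex `z` is
  `exp (G (s + z / σ_f) - G s - (z / σ_f) G' s)`. A third-order Taylor estimate, term by term in
  the series and again dominated by `e^{n / m}`, shows that the exponent is
  `z² / 2 + O(|z|³ g^{-1/2})` (`norm_evalC_sub_taylor_le`). Thus these functions converge to
  `e^{z² / 2}` uniformly on discs (`tendstoUniformlyOn_complexMGF`). The derivatives at `0`
  converge too, which are the moments, and the values on the imaginary axis give convergence in
  distribution by Lévy's theorem.

For the iterated exponentials, `e^g` is again a clan tending to infinity (`isClan_expSeries`), and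
`z` is a clan with `σ = 0`.
-/

open Filter Topology MeasureTheory ProbabilityTheory

namespace Khinchin

/-! ### Filters at the radius of convergence, and the Khinchin family as a tilted measure -/

theorem eventually_upTo_iff {b : EReal} (hb : ⊥ < b) {p : ℝ → Prop} :
    (∀ᶠ t in upTo b, p t) ↔ ∃ a : ℝ, (a : EReal) < b ∧ ∀ t : ℝ, a < t → (t : EReal) < b → p t := by
  rw [upTo, eventually_comap, Filter.Eventually, mem_nhdsLT_iff_exists_Ioo_subset' hb]
  constructor
  · rintro ⟨l, hl, h⟩
    obtain ⟨a, hla, hab⟩ := EReal.lt_iff_exists_real_btwn.1 hl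
    exact ⟨a, hab, fun t hat htb => h ⟨hla.trans (EReal.coe_lt_coe_iff.2 hat), htb⟩ t rfl⟩
  · rintro ⟨a, hab, h⟩
    refine ⟨a, hab, ?_⟩
    rintro _ ⟨hx1, hx2⟩ t rfl
    exact h t (EReal.coe_lt_coe_iff.1 hx1) hx2

theorem upTo_neBot {b : EReal} (hb : ⊥ < b) : (upTo b).NeBot := by
  rw [Filter.neBot_iff]
  intro h
  obtain ⟨a, hab, H⟩ := (eventually_upTo_iff (p := fun _ => False) hb).1
    (by rw [h]; exact eventually_bot)
  obtain ⟨c, hac, hcb⟩ := EReal.lt_iff_exists_real_btwn.1 hab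
  exact H c (EReal.coe_lt_coe_iff.1 hac) hcb

instance (b : EReal) : (upTo b).IsCountablyGenerated := by
  unfold upTo; infer_instance

theorem coe_lt_coe_ennreal_iff {t : ℝ} (ht : 0 ≤ t) (R : ENNReal) :
    (t : EReal) < (R : EReal) ↔ ENNReal.ofReal t < R := by
  rw [← EReal.coe_ennreal_lt_coe_ennreal_iff, EReal.coe_ennreal_ofReal, max_eq_left ht]

theorem bot_lt_coe_ennreal (R : ENNReal) : (⊥ : EReal) < R :=
  lt_of_lt_of_le EReal.bot_lt_zero (EReal.coe_ennreal_nonneg R)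

theorem eventually_mem_interval {f : PowerSeries ℝ} (hf : 0 < radius f) :
    ∀ᶠ t in upTo (radius f : EReal), t ∈ interval f := by
  rw [eventually_upTo_iff (bot_lt_coe_ennreal _)]
  refine ⟨0, ?_, fun t ht h => ⟨ht, (coe_lt_coe_ennreal_iff ht.le _).1 h⟩⟩
  exact EReal.coe_ennreal_pos.2 hf

theorem tendsto_exp_upTo (R : ENNReal) :
    Tendsto Real.exp (upTo (ENNReal.log R)) (upTo (R : EReal)) := by
  rw [upTo, upTo, tendsto_comap_iff]
  have h1 : Tendsto EReal.exp (𝓝[<] (ENNReal.log R)) (𝓝[<] R) := by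
    refine tendsto_nhdsWithin_iff.2 ⟨?_, ?_⟩
    · have h : Tendsto EReal.exp (𝓝 (ENNReal.log R)) (𝓝 (EReal.exp (ENNReal.log R))) :=
        EReal.expHomeomorph.continuous.tendsto _
      rw [ENNReal.exp_log] at h
      exact h.mono_left nhdsWithin_le_nhds
    · filter_upwards [self_mem_nhdsWithin] with x hx
      have := EReal.exp_lt_exp_iff.2 hx
      simpa using this
  have h2 : Tendsto (fun x : ENNReal => (x : EReal)) (𝓝[<] R) (𝓝[<] (R : EReal)) := by
    refine tendsto_nhdsWithin_iff.2 ⟨?_, ?_⟩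
    · exact (continuous_coe_ennreal_ereal.tendsto R).mono_left nhdsWithin_le_nhds
    · filter_upwards [self_mem_nhdsWithin] with x hx
      exact EReal.coe_ennreal_lt_coe_ennreal_iff.2 hx
  refine ((h2.comp h1).comp tendsto_comap).congr fun x => ?_
  simp [EReal.coe_ennreal_ofReal, (Real.exp_pos x).le]

/-- The measure `∑ aₙ δₙ` on `ℕ`. -/
noncomputable def coeffMeasure (f : PowerSeries ℝ) : Measure ℕ :=
  Measure.sum fun n : ℕ => ENNReal.ofReal (PowerSeries.coeff n f) • Measure.dirac n

theorem integrable_coeffMeasure_iff {f : PowerSeries ℝ} (hf : ∀ n, 0 ≤ PowerSeries.coeff n f)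
    {E : Type*} [NormedAddCommGroup E] {φ : ℕ → E} :
    Integrable φ (coeffMeasure f) ↔ Summable fun n => PowerSeries.coeff n f * ‖φ n‖ := by
  rw [coeffMeasure, integrable_sum_dirac_iff fun i => ENNReal.ofReal_ne_top]
  simp only [ENNReal.toReal_ofReal (hf _)]

theorem integral_coeffMeasure {f : PowerSeries ℝ} (hf : ∀ n, 0 ≤ PowerSeries.coeff n f)
    {E : Type*} [NormedAddCommGroup E] [NormedSpace ℝ E] [FiniteDimensional ℝ E] (φ : ℕ → E) :
    ∫ n, φ n ∂(coeffMeasure f) = ∑' n, PowerSeries.coeff n f • φ n := by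
  rw [coeffMeasure, integral_sum_dirac fun i => ENNReal.ofReal_ne_top]
  simp only [ENNReal.toReal_ofReal (hf _)]

theorem exp_mul_natCast (s : ℝ) (n : ℕ) : Real.exp (s * n) = Real.exp s ^ n := by
  rw [mul_comm, Real.exp_nat_mul]

theorem mgf_coeffMeasure {f : PowerSeries ℝ} (hf : ∀ n, 0 ≤ PowerSeries.coeff n f) (s : ℝ) :
    mgf (fun n : ℕ => (n : ℝ)) (coeffMeasure f) s = eval f (Real.exp s) := by
  simp only [mgf, integral_coeffMeasure hf, eval, exp_mul_natCast, smul_eq_mul]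

theorem fulcrum_eq_cgf {f : PowerSeries ℝ} (hf : ∀ n, 0 ≤ PowerSeries.coeff n f) :
    fulcrum f = cgf (fun n : ℕ => (n : ℝ)) (coeffMeasure f) := by
  ext s
  rw [fulcrum, cgf, mgf_coeffMeasure hf]

theorem isOpen_exp_mem_interval (f : PowerSeries ℝ) :
    IsOpen {s : ℝ | Real.exp s ∈ interval f} := by
  have : {s : ℝ | Real.exp s ∈ interval f}
      = (fun s => ENNReal.ofReal (Real.exp s)) ⁻¹' Set.Iio (radius f) := by
    ext s; simp [interval, Real.exp_pos]
  rw [this]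
  exact isOpen_Iio.preimage (ENNReal.continuous_ofReal.comp Real.continuous_exp)

theorem mem_interior_integrableExpSet {f : PowerSeries ℝ} (hf : ∀ n, 0 ≤ PowerSeries.coeff n f)
    {s : ℝ} (hs : Real.exp s ∈ interval f) :
    s ∈ interior (integrableExpSet (fun n : ℕ => (n : ℝ)) (coeffMeasure f)) := by
  refine interior_maximal (fun u hu => ?_) (isOpen_exp_mem_interval f) hs
  rw [integrableExpSet, Set.mem_ofPred_eq, integrable_coeffMeasure_iff hf]
  refine (summable_of_mem_interval hu).congr fun n => ?_
  rw [exp_mul_natCast, Real.norm_of_nonneg (by positivity)]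

/-- The Khinchin family is the exponential family obtained by tilting `∑ aₙ δₙ`. -/
theorem law_exp {f : PowerSeries ℝ} (hf : ∀ n, 0 ≤ PowerSeries.coeff n f) (s : ℝ) :
    law f (Real.exp s) = (coeffMeasure f).tilted fun n : ℕ => s * (n : ℝ) := by
  refine Measure.ext_of_singleton fun n => ?_
  rw [tilted_apply' _ _ (measurableSet_singleton n)]
  have h : ∫ n : ℕ, Real.exp (s * n) ∂(coeffMeasure f) = eval f (Real.exp s) :=
    mgf_coeffMeasure hf s
  rw [lintegral_singleton, h]
  have hs (c : ℕ → ENNReal) : (Measure.sum fun n : ℕ => c n • Measure.dirac n) {n} = c n := by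
    rw [Measure.sum_apply _ (measurableSet_singleton n), tsum_eq_single n]
    · simp
    · intro m hm; simp [hm]
  rw [law, hs, coeffMeasure, hs, ← ENNReal.ofReal_mul, exp_mul_natCast]
  · congr 1; ring
  · have : 0 ≤ eval f (Real.exp s) :=
      tsum_nonneg fun n => mul_nonneg (hf n) (pow_nonneg (Real.exp_pos s).le n)
    positivity

theorem mean_exp {f : PowerSeries ℝ} (hf : ∀ n, 0 ≤ PowerSeries.coeff n f)
    {s : ℝ} (hs : Real.exp s ∈ interval f) : mean f (Real.exp s) = deriv (fulcrum f) s := by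
  rw [mean, law_exp hf, fulcrum_eq_cgf hf,
    integral_tilted_mul_self (mem_interior_integrableExpSet hf hs)]

theorem variance_exp {f : PowerSeries ℝ} (hf : ∀ n, 0 ≤ PowerSeries.coeff n f)
    {s : ℝ} (hs : Real.exp s ∈ interval f) :
    variance (fun n : ℕ => (n : ℝ)) (law f (Real.exp s)) = iteratedDeriv 2 (fulcrum f) s := by
  rw [law_exp hf, fulcrum_eq_cgf hf,
    variance_tilted_mul (mem_interior_integrableExpSet hf hs)]

/-- The sum `∑ nᵏ aₙ tⁿ`, that is, `(t d/dt)ᵏ f (t)`. -/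
noncomputable def powerMoment (f : PowerSeries ℝ) (k : ℕ) (t : ℝ) : ℝ :=
  ∑' n : ℕ, PowerSeries.coeff n f * t ^ n * (n : ℝ) ^ k

theorem powerMoment_zero (f : PowerSeries ℝ) (t : ℝ) : powerMoment f 0 t = eval f t := by
  simp [powerMoment, eval]

theorem summable_powerMoment {f : PowerSeries ℝ} (hf : ∀ n, 0 ≤ PowerSeries.coeff n f) (k : ℕ)
    {t : ℝ} (ht : t ∈ interval f) :
    Summable fun n : ℕ => PowerSeries.coeff n f * t ^ n * (n : ℝ) ^ k := by
  have h0 := ht.1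
  have hs : Real.exp (Real.log t) ∈ interval f := by rwa [Real.exp_log h0]
  have := integrable_pow_mul_exp_of_mem_interior_integrableExpSet
    (mem_interior_integrableExpSet hf hs) k
  rw [integrable_coeffMeasure_iff hf] at this
  refine this.congr fun n => ?_
  rw [exp_mul_natCast, Real.exp_log h0, Real.norm_of_nonneg (by positivity)]
  ring

theorem iteratedDeriv_eval_exp {f : PowerSeries ℝ} (hf : ∀ n, 0 ≤ PowerSeries.coeff n f) (k : ℕ)
    {s : ℝ} (hs : Real.exp s ∈ interval f) :
    iteratedDeriv k (fun u => eval f (Real.exp u)) s = powerMoment f k (Real.exp s) := by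
  have h : (fun u => eval f (Real.exp u)) = mgf (fun n : ℕ => (n : ℝ)) (coeffMeasure f) :=
    funext fun u => (mgf_coeffMeasure hf u).symm
  rw [h, iteratedDeriv_mgf (mem_interior_integrableExpSet hf hs), integral_coeffMeasure hf]
  refine tsum_congr fun n => ?_
  rw [exp_mul_natCast, smul_eq_mul]; ring

theorem deriv_fulcrum {f : PowerSeries ℝ} (hf : ∀ n, 0 ≤ PowerSeries.coeff n f)
    {s : ℝ} (hs : Real.exp s ∈ interval f) :
    deriv (fulcrum f) s = powerMoment f 1 (Real.exp s) / eval f (Real.exp s) := by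
  rw [fulcrum_eq_cgf hf, deriv_cgf (mem_interior_integrableExpSet hf hs), mgf_coeffMeasure hf,
    integral_coeffMeasure hf]
  congr 1
  refine tsum_congr fun n => ?_
  rw [exp_mul_natCast, smul_eq_mul]; ring

theorem hasDerivAt_fulcrum {f : PowerSeries ℝ} (hf : ∀ n, 0 ≤ PowerSeries.coeff n f)
    {s : ℝ} (hs : Real.exp s ∈ interval f) :
    HasDerivAt (fulcrum f) (mean f (Real.exp s)) s := by
  rw [mean_exp hf hs, fulcrum_eq_cgf hf]
  exact (analyticAt_cgf (mem_interior_integrableExpSet hf hs)).differentiableAt.hasDerivAt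

theorem stdDev_sq {f : PowerSeries ℝ} {t : ℝ} :
    stdDev f t ^ 2 = variance (fun n : ℕ => (n : ℝ)) (law f t) :=
  Real.sq_sqrt (variance_nonneg _ _)

theorem hasDerivAt_mean {f : PowerSeries ℝ} (hf : ∀ n, 0 ≤ PowerSeries.coeff n f)
    {s : ℝ} (hs : Real.exp s ∈ interval f) :
    HasDerivAt (fun u => mean f (Real.exp u)) (stdDev f (Real.exp s) ^ 2) s := by
  have h : (fun u => mean f (Real.exp u)) =ᶠ[𝓝 s] deriv (fulcrum f) := by
    filter_upwards [(isOpen_exp_mem_interval f).mem_nhds hs] with u hu using mean_exp hf hu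
  rw [h.hasDerivAt_iff, stdDev_sq, variance_exp hf hs, iteratedDeriv_succ, iteratedDeriv_one,
    fulcrum_eq_cgf hf]
  exact (analyticAt_cgf (mem_interior_integrableExpSet hf hs)).deriv.differentiableAt.hasDerivAt

theorem mean_eq {f : PowerSeries ℝ} (hf : ∀ n, 0 ≤ PowerSeries.coeff n f)
    {t : ℝ} (ht : t ∈ interval f) : mean f t = powerMoment f 1 t / eval f t := by
  have hs : Real.exp (Real.log t) ∈ interval f := by rwa [Real.exp_log ht.1]
  have := (mean_exp hf hs).trans (deriv_fulcrum hf hs)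
  rwa [Real.exp_log ht.1] at this

theorem stdDev_sq_eq {f : PowerSeries ℝ} (hf : ∀ n, 0 ≤ PowerSeries.coeff n f)
    {t : ℝ} (ht : t ∈ interval f) :
    stdDev f t ^ 2 = powerMoment f 2 t / eval f t - mean f t ^ 2 := by
  have hs : Real.exp (Real.log t) ∈ interval f := by rwa [Real.exp_log ht.1]
  have h := variance_exp hf hs
  rw [fulcrum_eq_cgf hf, iteratedDeriv_two_cgf (mem_interior_integrableExpSet hf hs),
    mgf_coeffMeasure hf, integral_coeffMeasure hf, ← fulcrum_eq_cgf hf, ← mean_exp hf hs,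
    Real.exp_log ht.1] at h
  rw [stdDev_sq, h]
  congr 2
  refine tsum_congr fun n => ?_
  rw [exp_mul_natCast, Real.exp_log ht.1, smul_eq_mul]; ring

theorem mean_pos {f : PowerSeries ℝ} (hf : IsNonnegSeries f) {t : ℝ} (ht : t ∈ interval f) :
    0 < mean f t := by
  rw [mean_eq hf.coeff_nonneg ht]
  refine div_pos ?_ (eval_pos hf ht)
  obtain ⟨n, hn1, hn⟩ := hf.nonconstant
  have h0 := ht.1
  have hc := hf.coeff_nonneg
  refine (summable_powerMoment hf.coeff_nonneg 1 ht).tsum_pos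
    (fun k => by have := hc k; positivity) n ?_
  have h1 : 0 < PowerSeries.coeff n f := lt_of_le_of_ne (hc n) hn.symm
  have h2 : (0 : ℝ) < n := by exact_mod_cast hn1
  positivity

/-! ### The power series `e^g` -/

/-- The sum `∑ aₙ wⁿ` at a complex point `w`. -/
noncomputable def evalC (f : PowerSeries ℝ) (w : ℂ) : ℂ :=
  ∑' n : ℕ, ((PowerSeries.coeff n f : ℝ) : ℂ) * w ^ n

theorem evalC_ofReal (f : PowerSeries ℝ) (t : ℝ) : evalC f t = (eval f t : ℂ) := by
  simp only [evalC, eval, Complex.ofReal_tsum, Complex.ofReal_mul, Complex.ofReal_pow]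

theorem summable_norm_of_lt_radius {f : PowerSeries ℝ} {w : ℂ}
    (hw : ENNReal.ofReal ‖w‖ < radius f) :
    Summable fun n : ℕ => ‖((PowerSeries.coeff n f : ℝ) : ℂ) * w ^ n‖ := by
  refine ((FormalMultilinearSeries.ofScalars ℝ
    (fun n => PowerSeries.coeff n f)).summable_norm_mul_pow (r := ‖w‖.toNNReal) hw).congr
      fun n => ?_
  rw [FormalMultilinearSeries.ofScalars_norm, norm_mul, norm_pow, Complex.norm_real,
    Real.coe_toNNReal _ (norm_nonneg w)]

theorem le_radius_of_summable {f : PowerSeries ℝ} {r : NNReal}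
    (h : Summable fun n : ℕ => |PowerSeries.coeff n f| * (r : ℝ) ^ n) :
    (r : ENNReal) ≤ radius f := by
  refine FormalMultilinearSeries.le_radius_of_summable _ (h.congr fun n => ?_)
  rw [FormalMultilinearSeries.ofScalars_norm, Real.norm_eq_abs]

theorem coeff_mul_term (f g : PowerSeries ℝ) (w : ℂ) (n : ℕ) :
    ((PowerSeries.coeff n (f * g) : ℝ) : ℂ) * w ^ n
      = ∑ p ∈ Finset.HasAntidiagonal.antidiagonal n,
          (((PowerSeries.coeff p.1 f : ℝ) : ℂ) * w ^ p.1) *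
            (((PowerSeries.coeff p.2 g : ℝ) : ℂ) * w ^ p.2) := by
  rw [PowerSeries.coeff_mul, Complex.ofReal_sum, Finset.sum_mul]
  refine Finset.sum_congr rfl fun p hp => ?_
  rw [← Finset.HasAntidiagonal.mem_antidiagonal.1 hp, pow_add]
  push_cast
  ring

theorem summable_norm_evalC_pow {g : PowerSeries ℝ} {w : ℂ}
    (hw : Summable fun n : ℕ => ‖((PowerSeries.coeff n g : ℝ) : ℂ) * w ^ n‖) (k : ℕ) :
    (Summable fun n : ℕ => ‖((PowerSeries.coeff n (g ^ k) : ℝ) : ℂ) * w ^ n‖) ∧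
      evalC (g ^ k) w = evalC g w ^ k := by
  induction k with
  | zero =>
    have h : ∀ n, n ≠ 0 → ((PowerSeries.coeff n (g ^ 0) : ℝ) : ℂ) * w ^ n = 0 := by
      intro n hn
      simp [PowerSeries.coeff_one, hn]
    constructor
    · exact summable_of_ne_finset_zero (s := {0}) fun n hn => by
        rw [h n (by simpa using hn), norm_zero]
    · rw [evalC, tsum_eq_single 0 h]
      simp
  | succ k ih =>
    rw [pow_succ, pow_succ, ← ih.2]
    exact ⟨(summable_norm_sum_mul_antidiagonal_of_summable_norm ih.1 hw).congr fun n =>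
      congrArg norm (coeff_mul_term (g ^ k) g w n).symm,
      (tsum_congr (coeff_mul_term (g ^ k) g w)).trans
        (tsum_mul_tsum_eq_tsum_sum_antidiagonal_of_summable_norm ih.1 hw).symm⟩

theorem coeff_pow_nonneg {g : PowerSeries ℝ} (hg : ∀ n, 0 ≤ PowerSeries.coeff n g) (k n : ℕ) :
    0 ≤ PowerSeries.coeff n (g ^ k) := by
  induction k generalizing n with
  | zero =>
    rw [pow_zero, PowerSeries.coeff_one]
    split_ifs <;> norm_num
  | succ k ih =>
    rw [pow_succ, PowerSeries.coeff_mul]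
    exact Finset.sum_nonneg fun p _ => mul_nonneg (ih _) (hg _)

/-- The double series `∑ₖ ∑ₙ [zⁿ]gᵏ wⁿ / k!` converges absolutely inside the disc of
convergence of `g`: its absolute values sum to `exp (g |w|)`. -/
theorem summable_exp_double {g : PowerSeries ℝ} (hg : ∀ n, 0 ≤ PowerSeries.coeff n g) {w : ℂ}
    (hw : ENNReal.ofReal ‖w‖ < radius g) :
    Summable fun p : ℕ × ℕ =>
      ‖((PowerSeries.coeff p.2 (g ^ p.1) / (p.1.factorial : ℝ) : ℝ) : ℂ) * w ^ p.2‖ := by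
  have hw' : ENNReal.ofReal ‖((‖w‖ : ℝ) : ℂ)‖ < radius g := by simpa using hw
  have key := summable_norm_evalC_pow (summable_norm_of_lt_radius hw')
  have hterm (k n : ℕ) :
      ‖((PowerSeries.coeff n (g ^ k) / (k.factorial : ℝ) : ℝ) : ℂ) * w ^ n‖
        = (PowerSeries.coeff n (g ^ k) * ‖w‖ ^ n) / (k.factorial : ℝ) := by
    rw [norm_mul, norm_pow, Complex.norm_real, Real.norm_of_nonneg
      (div_nonneg (coeff_pow_nonneg hg k n) (Nat.cast_nonneg _))]
    ring
  have hS (k : ℕ) : Summable fun n : ℕ => PowerSeries.coeff n (g ^ k) * ‖w‖ ^ n := by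
    refine (key k).1.congr fun n => ?_
    rw [norm_mul, norm_pow, Complex.norm_real, Complex.norm_real, norm_norm,
      Real.norm_of_nonneg (coeff_pow_nonneg hg k n)]
  have hT (k : ℕ) : ∑' n : ℕ, PowerSeries.coeff n (g ^ k) * ‖w‖ ^ n = eval g ‖w‖ ^ k := by
    have h := (key k).2
    rw [evalC_ofReal, evalC_ofReal] at h
    exact_mod_cast h
  refine (summable_prod_of_nonneg fun p => norm_nonneg _).2 ⟨fun k => ?_, ?_⟩
  · simp only [hterm]
    exact (hS k).div_const _
  · simp only [hterm, tsum_div_const, hT]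
    exact Real.summable_pow_div_factorial _

theorem summable_coeff_pow_div_factorial {g : PowerSeries ℝ} (hR : 0 < radius g)
    (hg : ∀ n, 0 ≤ PowerSeries.coeff n g) (n : ℕ) :
    Summable fun k : ℕ => PowerSeries.coeff n (g ^ k) / (k.factorial : ℝ) := by
  obtain ⟨r, h0, hr⟩ := ENNReal.lt_iff_exists_nnreal_btwn.1 hR
  have hr0 : (r : ℝ) ≠ 0 := by
    have : 0 < r := by exact_mod_cast h0
    exact_mod_cast this.ne'
  have h := (summable_exp_double hg (w := ((r : ℝ) : ℂ))
    (by simpa using hr)).prod_symm.prod_factor n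
  have h2 := h.mul_right (((r : ℝ) ^ n)⁻¹)
  refine h2.congr fun k => ?_
  simp only [Prod.swap_prod_mk]
  rw [norm_mul, norm_pow, Complex.norm_real, Complex.norm_real, Real.norm_of_nonneg
    (div_nonneg (coeff_pow_nonneg hg k n) (Nat.cast_nonneg _)),
    Real.norm_of_nonneg (NNReal.coe_nonneg r),
    mul_assoc, mul_inv_cancel₀ (pow_ne_zero n hr0), mul_one]

theorem coeff_expSeries (g : PowerSeries ℝ) (n : ℕ) : PowerSeries.coeff n (expSeries g)
    = ∑' k : ℕ, PowerSeries.coeff n (g ^ k) / (k.factorial : ℝ) := by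
  rw [expSeries, PowerSeries.coeff_mk]

theorem coeff_expSeries_nonneg {g : PowerSeries ℝ} (hg : ∀ n, 0 ≤ PowerSeries.coeff n g) (n : ℕ) :
    0 ≤ PowerSeries.coeff n (expSeries g) := by
  rw [coeff_expSeries]
  exact tsum_nonneg fun k => div_nonneg (coeff_pow_nonneg hg k n) (Nat.cast_nonneg _)

theorem coeff_pow_div_factorial_le {g : PowerSeries ℝ} (hR : 0 < radius g)
    (hg : ∀ n, 0 ≤ PowerSeries.coeff n g) (n k : ℕ) :
    PowerSeries.coeff n (g ^ k) / (k.factorial : ℝ) ≤ PowerSeries.coeff n (expSeries g) := by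
  rw [coeff_expSeries]
  exact (summable_coeff_pow_div_factorial hR hg n).le_tsum k
    fun j _ => div_nonneg (coeff_pow_nonneg hg j n) (Nat.cast_nonneg _)

theorem evalC_expSeries_term {g : PowerSeries ℝ} (w : ℂ) (n : ℕ) :
    ((PowerSeries.coeff n (expSeries g) : ℝ) : ℂ) * w ^ n
      = ∑' k : ℕ, ((PowerSeries.coeff n (g ^ k) / (k.factorial : ℝ) : ℝ) : ℂ) * w ^ n := by
  rw [tsum_mul_right, coeff_expSeries, Complex.ofReal_tsum]

theorem evalC_expSeries {g : PowerSeries ℝ} (hg : ∀ n, 0 ≤ PowerSeries.coeff n g) {w : ℂ}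
    (hw : ENNReal.ofReal ‖w‖ < radius g) :
    evalC (expSeries g) w = Complex.exp (evalC g w) := by
  have hcomm := Summable.tsum_comm (f := fun k n : ℕ =>
    ((PowerSeries.coeff n (g ^ k) / (k.factorial : ℝ) : ℝ) : ℂ) * w ^ n)
    (summable_exp_double hg hw).of_norm
  rw [evalC, tsum_congr (evalC_expSeries_term w), hcomm, Complex.exp_eq_exp_ℂ,
    NormedSpace.exp_eq_tsum_div]
  refine tsum_congr fun k => ?_
  rw [← (summable_norm_evalC_pow (summable_norm_of_lt_radius hw) k).2, evalC, ← tsum_div_const]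
  refine tsum_congr fun n => ?_
  push_cast
  ring

theorem radius_expSeries {g : PowerSeries ℝ} (hR : 0 < radius g)
    (hg : ∀ n, 0 ≤ PowerSeries.coeff n g) : radius (expSeries g) = radius g := by
  refine le_antisymm ?_ ?_
  · refine ENNReal.le_of_forall_nnreal_lt fun r hr => le_radius_of_summable ?_
    have h := summable_norm_of_lt_radius (f := expSeries g) (w := ((r : ℝ) : ℂ)) (by simpa using hr)
    refine h.of_nonneg_of_le (fun n => by positivity) fun n => ?_
    rw [norm_mul, norm_pow, Complex.norm_real, Complex.norm_real,
      Real.norm_of_nonneg (NNReal.coe_nonneg r),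
      Real.norm_eq_abs, abs_of_nonneg (hg n), abs_of_nonneg (coeff_expSeries_nonneg hg n)]
    have := coeff_pow_div_factorial_le hR hg n 1
    rw [pow_one, Nat.factorial_one, Nat.cast_one, div_one] at this
    gcongr
  · refine ENNReal.le_of_forall_nnreal_lt fun r hr => le_radius_of_summable ?_
    have h := summable_exp_double hg (w := ((r : ℝ) : ℂ)) (by simpa using hr)
    refine h.prod_symm.prod.congr fun n => ?_
    rw [abs_of_nonneg (coeff_expSeries_nonneg hg n), coeff_expSeries, ← tsum_mul_right]
    refine tsum_congr fun k => ?_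
    simp only [Prod.swap_prod_mk]
    rw [norm_mul, norm_pow, Complex.norm_real, Complex.norm_real,
      Real.norm_of_nonneg (NNReal.coe_nonneg r),
      Real.norm_of_nonneg (div_nonneg (coeff_pow_nonneg hg k n) (Nat.cast_nonneg _))]

theorem eval_expSeries {g : PowerSeries ℝ} (hg : ∀ n, 0 ≤ PowerSeries.coeff n g) {t : ℝ}
    (ht : ENNReal.ofReal |t| < radius g) : eval (expSeries g) t = Real.exp (eval g t) := by
  have h := evalC_expSeries hg (w := (t : ℂ)) (by simpa using ht)
  rw [evalC_ofReal, evalC_ofReal] at h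
  exact_mod_cast h

theorem interval_expSeries {g : PowerSeries ℝ} (hR : 0 < radius g)
    (hg : ∀ n, 0 ≤ PowerSeries.coeff n g) : interval (expSeries g) = interval g := by
  rw [interval, interval, radius_expSeries hR hg]

theorem inClassK_expSeries {g : PowerSeries ℝ} (hg : IsNonnegSeries g) :
    InClassK (expSeries g) where
  radius_pos := by rw [radius_expSeries hg.radius_pos hg.coeff_nonneg]; exact hg.radius_pos
  coeff_nonneg := coeff_expSeries_nonneg hg.coeff_nonneg
  nonconstant := by
    obtain ⟨n, hn1, hn⟩ := hg.nonconstant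
    refine ⟨n, hn1, ne_of_gt ?_⟩
    have := coeff_pow_div_factorial_le hg.radius_pos hg.coeff_nonneg n 1
    rw [pow_one, Nat.factorial_one, Nat.cast_one, div_one] at this
    exact (lt_of_le_of_ne (hg.coeff_nonneg n) hn.symm).trans_le this
  constantCoeff_pos := by
    have := coeff_pow_div_factorial_le hg.radius_pos hg.coeff_nonneg 0 0
    rw [pow_zero, Nat.factorial_zero, Nat.cast_one, div_one, PowerSeries.coeff_one,
      if_pos rfl] at this
    exact one_pos.trans_le this

/-- Inside the interval of convergence the fulcrum of `e^g` is `s ↦ g (eˢ)`. -/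
theorem fulcrum_expSeries {g : PowerSeries ℝ} (hg : ∀ n, 0 ≤ PowerSeries.coeff n g) {s : ℝ}
    (hs : Real.exp s ∈ interval g) : fulcrum (expSeries g) s = eval g (Real.exp s) := by
  rw [fulcrum, eval_expSeries hg, Real.log_exp]
  rw [abs_of_pos (Real.exp_pos s)]
  exact hs.2

theorem iteratedDeriv_fulcrum_expSeries {g : PowerSeries ℝ}
    (hg : ∀ n, 0 ≤ PowerSeries.coeff n g) (k : ℕ) {s : ℝ} (hs : Real.exp s ∈ interval g) :
    iteratedDeriv k (fulcrum (expSeries g)) s = powerMoment g k (Real.exp s) := by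
  rw [← iteratedDeriv_eval_exp hg k hs]
  refine Filter.EventuallyEq.iteratedDeriv_eq k ?_
  filter_upwards [(isOpen_exp_mem_interval g).mem_nhds hs] with u hu using fulcrum_expSeries hg hu

theorem mean_expSeries {g : PowerSeries ℝ} (hg : IsNonnegSeries g) {t : ℝ} (ht : t ∈ interval g) :
    mean (expSeries g) t = powerMoment g 1 t := by
  have hs : Real.exp (Real.log t) ∈ interval g := by rwa [Real.exp_log ht.1]
  have h := mean_exp (inClassK_expSeries hg).coeff_nonneg
    (by rwa [interval_expSeries hg.radius_pos hg.coeff_nonneg] : _ ∈ interval (expSeries g))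
  rwa [← iteratedDeriv_one, iteratedDeriv_fulcrum_expSeries hg.coeff_nonneg 1 hs,
    Real.exp_log ht.1] at h

theorem stdDev_expSeries {g : PowerSeries ℝ} (hg : IsNonnegSeries g) {t : ℝ}
    (ht : t ∈ interval g) : stdDev (expSeries g) t = √(powerMoment g 2 t) := by
  have hs : Real.exp (Real.log t) ∈ interval g := by rwa [Real.exp_log ht.1]
  have h := variance_exp (inClassK_expSeries hg).coeff_nonneg
    (by rwa [interval_expSeries hg.radius_pos hg.coeff_nonneg] : _ ∈ interval (expSeries g))
  rw [iteratedDeriv_fulcrum_expSeries hg.coeff_nonneg 2 hs, Real.exp_log ht.1] at h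
  rw [stdDev, h]

/-! ### Growth of clans -/

theorem mem_interval_of_le {f : PowerSeries ℝ} {x t : ℝ} (h0 : 0 < x) (hxt : x ≤ t)
    (ht : t ∈ interval f) : x ∈ interval f :=
  ⟨h0, (ENNReal.ofReal_le_ofReal hxt).trans_lt ht.2⟩

/-- While `σ² ≤ m² / 2`, the function `1 / m (eˢ)` has slope at least `-1/2`. Hence `m` at most
doubles over a step of length `1 / m (eˢ)`, and `log g (eˢ)`, whose derivative is `m (eˢ)`,
increases by at most `2`. -/
theorem fulcrum_le_add_two {g : PowerSeries ℝ} (hg : IsNonnegSeries g) {s s' : ℝ}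
    (hss' : s ≤ s') (hs' : s' ≤ s + 1 / mean g (Real.exp s)) (hmem : Real.exp s' ∈ interval g)
    (hclan : ∀ u ∈ Set.Icc s s',
      stdDev g (Real.exp u) ^ 2 ≤ mean g (Real.exp u) ^ 2 / 2) :
    fulcrum g s' ≤ fulcrum g s + 2 := by
  have hc := hg.coeff_nonneg
  have hm : ∀ u ∈ Set.Icc s s', Real.exp u ∈ interval g := fun u hu =>
    mem_interval_of_le (Real.exp_pos u) (Real.exp_le_exp.2 hu.2) hmem
  have hpos : ∀ u ∈ Set.Icc s s', 0 < mean g (Real.exp u) := fun u hu => mean_pos hg (hm u hu)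
  have hs : s ∈ Set.Icc s s' := Set.left_mem_Icc.2 hss'
  have hd : ∀ u ∈ Set.Icc s s', HasDerivAt (fun u => (mean g (Real.exp u))⁻¹)
      (-stdDev g (Real.exp u) ^ 2 / mean g (Real.exp u) ^ 2) u := fun u hu =>
    (hasDerivAt_mean hc (hm u hu)).fun_inv (hpos u hu).ne'
  have hbound : ∀ u ∈ Set.Icc s s', mean g (Real.exp u) ≤ 2 * mean g (Real.exp s) := by
    intro u hu
    have h1 := (convex_Icc s s').mul_sub_le_image_sub_of_le_deriv
      (fun v hv => (hd v hv).continuousAt.continuousWithinAt)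
      (fun v hv => (hd v (interior_subset hv)).differentiableAt.differentiableWithinAt)
      (C := -(1 / 2)) (fun v hv => by
        have hv := interior_subset hv
        rw [(hd v hv).deriv, neg_div, neg_le_neg_iff,
          div_le_iff₀ (pow_pos (hpos v hv) 2)]
        linarith [hclan v hv]) s hs u hu hu.1
    have h2 : (2 * mean g (Real.exp s))⁻¹ ≤ (mean g (Real.exp u))⁻¹ := by
      have h3 : u - s ≤ (mean g (Real.exp s))⁻¹ := by
        rw [← one_div]; linarith [hu.2]
      rw [mul_inv]
      linarith
    exact (inv_le_inv₀ (mul_pos two_pos (hpos s hs)) (hpos u hu)).1 h2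
  have hF : ∀ u ∈ Set.Icc s s', HasDerivAt (fulcrum g) (mean g (Real.exp u)) u := fun u hu =>
    hasDerivAt_fulcrum hc (hm u hu)
  have h4 := (convex_Icc s s').image_sub_le_mul_sub_of_deriv_le
      (fun v hv => (hF v hv).continuousAt.continuousWithinAt)
      (fun v hv => (hF v (interior_subset hv)).differentiableAt.differentiableWithinAt)
      (C := 2 * mean g (Real.exp s)) (fun v hv => by
        rw [(hF v (interior_subset hv)).deriv]
        exact hbound v (interior_subset hv)) s hs s' (Set.right_mem_Icc.2 hss') hss'
  have h5 : 2 * mean g (Real.exp s) * (s' - s)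
      ≤ 2 * mean g (Real.exp s) * (1 / mean g (Real.exp s)) :=
    mul_le_mul_of_nonneg_left (by linarith) (mul_pos two_pos (hpos s hs)).le
  have h6 : 2 * mean g (Real.exp s) * (1 / mean g (Real.exp s)) = 2 := by
    have := (hpos s hs).ne'
    field_simp
  linarith

/-- A clan that tends to infinity grows by a bounded factor when `log t` increases by `1 / m (t)`,
and `t e^{1 / m (t)}` stays below the radius of convergence. -/
theorem eventually_eval_mul_exp_le {g : PowerSeries ℝ} (hg : IsNonnegSeries g) (hclan : IsClan g)
    (hdiv : Tendsto (eval g) (upTo (radius g : EReal)) atTop) :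
    ∀ᶠ t in upTo (radius g : EReal), t * Real.exp (1 / mean g t) ∈ interval g ∧
      eval g (t * Real.exp (1 / mean g t)) ≤ Real.exp 2 * eval g t := by
  have hne := upTo_neBot (bot_lt_coe_ennreal (radius g))
  have hev : ∀ᶠ t in upTo (radius g : EReal), t ∈ interval g ∧
      stdDev g t ^ 2 ≤ mean g t ^ 2 / 2 := by
    filter_upwards [eventually_mem_interval hg.radius_pos,
      hclan.eventually (eventually_lt_nhds (show (0 : ℝ) < 1 / 2 by norm_num))] with t ht hlt
    refine ⟨ht, ?_⟩
    rw [div_lt_iff₀ (mean_pos hg ht)] at hlt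
    have := pow_le_pow_left₀ (Real.sqrt_nonneg _) hlt.le 2
    rw [← stdDev] at this
    nlinarith [sq_nonneg (mean g t)]
  obtain ⟨a, haR, ha⟩ := (eventually_upTo_iff (bot_lt_coe_ennreal _)).1 hev
  have hgt : ∀ᶠ t in upTo (radius g : EReal), a < t ∧ t ∈ interval g := by
    refine Filter.Eventually.and ?_ (eventually_mem_interval hg.radius_pos)
    rw [eventually_upTo_iff (bot_lt_coe_ennreal _)]
    exact ⟨a, haR, fun t h _ => h⟩
  filter_upwards [hgt] with t ht
  obtain ⟨hat, ht⟩ := ht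
  have hs : Real.exp (Real.log t) = t := Real.exp_log ht.1
  have hstep : ∀ s', Real.log t ≤ s' → s' ≤ Real.log t + 1 / mean g t → Real.exp s' ∈ interval g →
      eval g (Real.exp s') ≤ Real.exp 2 * eval g t := by
    intro s' h1 h2 h3
    have h := fulcrum_le_add_two hg h1 (by rwa [hs]) h3 fun u hu => by
      have hu1 : t ≤ Real.exp u := by rw [← hs]; exact Real.exp_le_exp.2 hu.1
      have hu2 := mem_interval_of_le (Real.exp_pos u) (Real.exp_le_exp.2 hu.2) h3
      exact (ha _ (hat.trans_le hu1) ((coe_lt_coe_ennreal_iff hu2.1.le _).2 hu2.2)).2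
    rw [fulcrum, fulcrum, hs] at h
    have h' := Real.exp_le_exp.2 h
    rwa [Real.exp_log (eval_pos hg h3), Real.exp_add, Real.exp_log (eval_pos hg ht),
      mul_comm] at h'
  have hexp : t * Real.exp (1 / mean g t) = Real.exp (Real.log t + 1 / mean g t) := by
    rw [Real.exp_add, hs]
  have hle : Real.log t ≤ Real.log t + 1 / mean g t := by
    have := mean_pos hg ht
    have : 0 < 1 / mean g t := by positivity
    linarith
  rw [hexp]
  -- Otherwise `g` would be bounded by `e² g t` up to the radius of convergence.
  have hmem : Real.exp (Real.log t + 1 / mean g t) ∈ interval g := by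
    by_contra hnot
    have hlt : ∀ᶠ x in upTo (radius g : EReal), t < x := by
      rw [eventually_upTo_iff (bot_lt_coe_ennreal _)]
      exact ⟨t, (coe_lt_coe_ennreal_iff ht.1.le _).2 ht.2, fun x h _ => h⟩
    obtain ⟨x, hx1, hx2, hx3⟩ := (hlt.and ((hdiv.eventually_gt_atTop (Real.exp 2 * eval g t)).and
      (eventually_mem_interval hg.radius_pos))).exists
    have hx : Real.exp (Real.log x) = x := Real.exp_log hx3.1
    refine absurd (hstep (Real.log x) (Real.log_le_log ht.1 hx1.le) ?_ (by rwa [hx])) ?_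
    · by_contra hcon
      refine hnot (mem_interval_of_le (Real.exp_pos _) ?_ hx3)
      rw [← hx]
      exact Real.exp_le_exp.2 (not_le.1 hcon).le
    · rw [hx]
      exact not_le.2 hx2
  exact ⟨hmem, hstep _ hle le_rfl hmem⟩

/-! ### Taylor expansion of the fulcrum and convergence of the moment generating functions -/

/-- The Cauchy–Schwarz inequality `(∑ n aₙ tⁿ)² ≤ (∑ aₙ tⁿ) (∑ n² aₙ tⁿ)`, divided by `g t`. -/
theorem eval_mul_mean_sq_le {g : PowerSeries ℝ} (hg : IsNonnegSeries g) {t : ℝ}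
    (ht : t ∈ interval g) : eval g t * mean g t ^ 2 ≤ powerMoment g 2 t := by
  have h := stdDev_sq_eq hg.coeff_nonneg ht
  have h2 : mean g t ^ 2 ≤ powerMoment g 2 t / eval g t := by linarith [sq_nonneg (stdDev g t)]
  rw [le_div_iff₀ (eval_pos hg ht)] at h2
  linarith

theorem summable_mul_exp {g : PowerSeries ℝ} {t m : ℝ} (htm : t * Real.exp (1 / m) ∈ interval g) :
    Summable fun n : ℕ => PowerSeries.coeff n g * t ^ n * Real.exp (n / m) := by
  refine (summable_of_mem_interval htm).congr fun n => ?_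
  rw [mul_pow, ← Real.exp_nat_mul, mul_one_div, mul_assoc]

theorem tsum_mul_exp (g : PowerSeries ℝ) (t m : ℝ) :
    ∑' n : ℕ, PowerSeries.coeff n g * t ^ n * Real.exp (n / m)
      = eval g (t * Real.exp (1 / m)) := by
  refine tsum_congr fun n => ?_
  rw [mul_pow, ← Real.exp_nat_mul, mul_one_div, mul_assoc]

theorem powerMoment_le {g : PowerSeries ℝ} (hg : ∀ n, 0 ≤ PowerSeries.coeff n g) {t m : ℝ}
    (hm : 0 < m) (ht : t ∈ interval g) (htm : t * Real.exp (1 / m) ∈ interval g) (k : ℕ) :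
    powerMoment g k t ≤ k.factorial * m ^ k * eval g (t * Real.exp (1 / m)) := by
  rw [← tsum_mul_exp, ← tsum_mul_left]
  refine (summable_powerMoment hg k ht).tsum_le_tsum (fun n => ?_)
    ((summable_mul_exp htm).mul_left _)
  have h := Real.pow_div_factorial_le_exp (n / m) (by positivity) k
  rw [div_pow, div_div, div_le_iff₀ (by positivity)] at h
  have h0 : 0 ≤ PowerSeries.coeff n g * t ^ n := mul_nonneg (hg n) (pow_nonneg ht.1.le n)
  calc PowerSeries.coeff n g * t ^ n * (n : ℝ) ^ k
      ≤ PowerSeries.coeff n g * t ^ n * (Real.exp (n / m) * (m ^ k * k.factorial)) := by gcongr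
    _ = _ := by ring

theorem tendsto_powerMoment_div_rpow {g : PowerSeries ℝ} (hg : IsNonnegSeries g)
    (hclan : IsClan g) (hdiv : Tendsto (eval g) (upTo (radius g : EReal)) atTop) {k : ℕ}
    (hk : 3 ≤ k) :
    Tendsto (fun t => powerMoment g k t / powerMoment g 2 t ^ ((k : ℝ) / 2))
      (upTo (radius g : EReal)) (𝓝 0) := by
  have hk' : 0 < (k : ℝ) / 2 - 1 := by
    have : (3 : ℝ) ≤ k := by exact_mod_cast hk
    linarith
  have hlim : Tendsto (fun t => k.factorial * Real.exp 2 * eval g t ^ (-((k : ℝ) / 2 - 1)))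
      (upTo (radius g : EReal)) (𝓝 0) := by
    have := ((tendsto_rpow_neg_atTop hk').comp hdiv).const_mul (k.factorial * Real.exp 2)
    rwa [mul_zero] at this
  refine squeeze_zero' ?_ ?_ hlim
  · filter_upwards [eventually_mem_interval hg.radius_pos] with t ht
    have h (j : ℕ) : 0 ≤ powerMoment g j t := tsum_nonneg fun n =>
      mul_nonneg (mul_nonneg (hg.coeff_nonneg n) (pow_nonneg ht.1.le n)) (by positivity)
    exact div_nonneg (h k) (Real.rpow_nonneg (h 2) _)
  · filter_upwards [eventually_mem_interval hg.radius_pos,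
      eventually_eval_mul_exp_le hg hclan hdiv] with t ht htm
    have hA := eval_pos hg ht
    have hm := mean_pos hg ht
    have h1 := powerMoment_le hg.coeff_nonneg hm ht htm.1 k
    have h2 : eval g t ^ ((k : ℝ) / 2) * mean g t ^ k ≤ powerMoment g 2 t ^ ((k : ℝ) / 2) := by
      have h := Real.rpow_le_rpow (by positivity) (eval_mul_mean_sq_le hg ht)
        (by positivity : (0 : ℝ) ≤ (k : ℝ) / 2)
      rwa [Real.mul_rpow hA.le (by positivity), ← Real.rpow_natCast (mean g t) 2,
        ← Real.rpow_mul hm.le, Nat.cast_two, mul_div_cancel₀ _ (two_ne_zero' ℝ),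
        Real.rpow_natCast] at h
    have h3 : 0 < eval g t ^ ((k : ℝ) / 2) * mean g t ^ k := by positivity
    rw [div_le_iff₀ (h3.trans_le h2)]
    calc powerMoment g k t
        ≤ k.factorial * mean g t ^ k * (Real.exp 2 * eval g t) := h1.trans (by gcongr; exact htm.2)
      _ = k.factorial * Real.exp 2 * eval g t ^ (-((k : ℝ) / 2 - 1)) *
            (eval g t ^ ((k : ℝ) / 2) * mean g t ^ k) := by
          have : eval g t ^ (-((k : ℝ) / 2 - 1)) * eval g t ^ ((k : ℝ) / 2) = eval g t := by
            rw [← Real.rpow_add hA]; norm_num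
          linear_combination (-(k.factorial * mean g t ^ k * Real.exp 2)) * this
      _ ≤ _ := by gcongr

/-- A cubic Taylor remainder for `|w| ≤ q x` with `q ≤ 1/2`: half of the exponent in `eˣ` absorbs
`e^{|w|}`, the other half absorbs `x³`, and only the small factor `q³` remains. -/
theorem norm_exp_sub_taylor_le {w : ℂ} {x q : ℝ} (hx : 0 ≤ x) (hq : q ≤ 1 / 2) (hq0 : 0 ≤ q)
    (hw : ‖w‖ ≤ q * x) :
    ‖Complex.exp w - 1 - w - w ^ 2 / 2‖ ≤ 48 * q ^ 3 * Real.exp x := by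
  have h1 := Complex.norm_exp_sub_sum_le_norm_mul_exp w 3
  have h2 : Complex.exp w - ∑ m ∈ Finset.range 3, w ^ m / (m.factorial : ℂ)
      = Complex.exp w - 1 - w - w ^ 2 / 2 := by
    simp [Finset.sum_range_succ]
    ring
  rw [h2] at h1
  have h3 := Real.pow_div_factorial_le_exp (x / 2) (by positivity) 3
  have h4 : x ^ 3 ≤ 48 * Real.exp (x / 2) := by
    norm_num [Nat.factorial] at h3
    nlinarith
  calc _ ≤ ‖w‖ ^ 3 * Real.exp ‖w‖ := h1
    _ ≤ (q * x) ^ 3 * Real.exp (x / 2) := by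
        gcongr
        nlinarith
    _ = q ^ 3 * x ^ 3 * Real.exp (x / 2) := by ring
    _ ≤ q ^ 3 * (48 * Real.exp (x / 2)) * Real.exp (x / 2) := by gcongr
    _ = 48 * q ^ 3 * (Real.exp (x / 2) * Real.exp (x / 2)) := by ring
    _ = 48 * q ^ 3 * Real.exp x := by rw [← Real.exp_add, add_halves]

theorem powerMoment_two_pos {g : PowerSeries ℝ} (hg : IsNonnegSeries g) {t : ℝ}
    (ht : t ∈ interval g) : 0 < powerMoment g 2 t :=
  lt_of_lt_of_le (mul_pos (eval_pos hg ht) (pow_pos (mean_pos hg ht) 2))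
    (eval_mul_mean_sq_le hg ht)

theorem norm_div_sqrt_le {g : PowerSeries ℝ} (hg : IsNonnegSeries g) {t : ℝ}
    (ht : t ∈ interval g) (z : ℂ) :
    ‖z‖ / √(powerMoment g 2 t) ≤ ‖z‖ / √(eval g t) * (1 / mean g t) := by
  have hA := eval_pos hg ht
  have hm := mean_pos hg ht
  have h : √(eval g t) * mean g t ≤ √(powerMoment g 2 t) := by
    refine Real.le_sqrt_of_sq_le ?_
    rw [mul_pow, Real.sq_sqrt hA.le]
    exact eval_mul_mean_sq_le hg ht
  have h0 : 0 < √(eval g t) * mean g t := by positivity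
  rw [div_mul_div_comm, mul_one]
  gcongr

/-- Second-order expansion of `u ↦ g (t eᵘ)` at the complex point `u = z / σ`, with
`σ² = ∑ n² aₙ tⁿ`. -/
theorem norm_evalC_sub_taylor_le {g : PowerSeries ℝ} (hg : IsNonnegSeries g) {t : ℝ}
    (ht : t ∈ interval g) (htm : t * Real.exp (1 / mean g t) ∈ interval g)
    {z : ℂ} (hz : ‖z‖ / √(eval g t) ≤ 1 / 2) :
    ‖evalC g (t * Complex.exp (z / (√(powerMoment g 2 t) : ℝ))) - eval g t
        - z / (√(powerMoment g 2 t) : ℝ) * (powerMoment g 1 t : ℝ) - z ^ 2 / 2‖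
      ≤ 48 * (‖z‖ / √(eval g t)) ^ 3 * eval g (t * Real.exp (1 / mean g t)) := by
  have hc := hg.coeff_nonneg
  have hm := mean_pos hg ht
  have hM := powerMoment_two_pos hg ht
  set σ : ℝ := √(powerMoment g 2 t) with hσ
  have hσ0 : 0 < σ := Real.sqrt_pos.2 hM
  set q : ℝ := ‖z‖ / √(eval g t) with hq
  have hq0 : 0 ≤ q := by positivity
  have hw (n : ℕ) : ‖(n : ℂ) * (z / (σ : ℂ))‖ ≤ q * (n / mean g t) := by
    rw [norm_mul, norm_div, Complex.norm_real, Complex.norm_natCast, Real.norm_of_nonneg hσ0.le]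
    calc (n : ℝ) * (‖z‖ / σ) ≤ n * (q * (1 / mean g t)) := by
          gcongr; exact norm_div_sqrt_le hg ht z
      _ = _ := by ring
  have hterm (n : ℕ) : ‖((PowerSeries.coeff n g * t ^ n : ℝ) : ℂ) *
      (Complex.exp (n * (z / (σ : ℂ))) - 1 - n * (z / (σ : ℂ)) - (n * (z / (σ : ℂ))) ^ 2 / 2)‖
      ≤ 48 * q ^ 3 * (PowerSeries.coeff n g * t ^ n * Real.exp (n / mean g t)) := by
    have h0 : 0 ≤ PowerSeries.coeff n g * t ^ n := mul_nonneg (hc n) (pow_nonneg ht.1.le n)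
    rw [norm_mul, Complex.norm_real, Real.norm_of_nonneg h0]
    calc _ ≤ PowerSeries.coeff n g * t ^ n * (48 * q ^ 3 * Real.exp (n / mean g t)) := by
          gcongr
          exact norm_exp_sub_taylor_le (by positivity) hz hq0 (hw n)
      _ = _ := by ring
  have hpm (k : ℕ) : HasSum
      (fun n : ℕ => ((PowerSeries.coeff n g * t ^ n * (n : ℝ) ^ k : ℝ) : ℂ))
      (powerMoment g k t : ℝ) := Complex.hasSum_ofReal.2 (summable_powerMoment hc k ht).hasSum
  have hE : HasSum (fun n : ℕ => ((PowerSeries.coeff n g : ℝ) : ℂ) *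
      (t * Complex.exp (z / (σ : ℂ))) ^ n) (evalC g (t * Complex.exp (z / (σ : ℂ)))) := by
    refine (summable_norm_of_lt_radius ?_).of_norm.hasSum
    have hn : ‖(t : ℂ) * Complex.exp (z / (σ : ℂ))‖ ≤ t * Real.exp (1 / mean g t) := by
      rw [norm_mul, Complex.norm_real, Real.norm_of_nonneg ht.1.le, Complex.norm_exp]
      refine mul_le_mul_of_nonneg_left (Real.exp_le_exp.2 ?_) ht.1.le
      refine (Complex.re_le_norm _).trans ?_
      rw [norm_div, Complex.norm_real, Real.norm_of_nonneg hσ0.le]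
      refine (norm_div_sqrt_le hg ht z).trans ?_
      have : 0 < 1 / mean g t := by positivity
      nlinarith
    exact (ENNReal.ofReal_le_ofReal hn).trans_lt htm.2
  have hS := ((hE.sub (hpm 0)).sub ((hpm 1).mul_left (z / (σ : ℂ)))).sub
    ((hpm 2).mul_left ((z / (σ : ℂ)) ^ 2 / 2))
  have hval : (z / (σ : ℂ)) ^ 2 / 2 * ((powerMoment g 2 t : ℝ) : ℂ) = z ^ 2 / 2 := by
    have : ((powerMoment g 2 t : ℝ) : ℂ) = (σ : ℂ) ^ 2 := by
      rw [hσ, ← Complex.ofReal_pow, Real.sq_sqrt hM.le]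
    have hσc : (σ : ℂ) ≠ 0 := by exact_mod_cast hσ0.ne'
    rw [this]
    field_simp
  rw [hval, powerMoment_zero] at hS
  rw [← hS.tsum_eq, ← tsum_mul_exp, ← tsum_mul_left]
  refine tsum_of_norm_bounded ((summable_mul_exp htm).mul_left _).hasSum fun n => ?_
  refine le_trans (le_of_eq (congrArg norm ?_)) (hterm n)
  rw [mul_pow, ← Complex.exp_nat_mul]
  push_cast
  ring

theorem integral_law {f : PowerSeries ℝ} (hf : ∀ n, 0 ≤ PowerSeries.coeff n f) {t : ℝ}
    (ht : 0 ≤ t) {E : Type*} [NormedAddCommGroup E] [NormedSpace ℝ E] [FiniteDimensional ℝ E]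
    (φ : ℕ → E) :
    ∫ n, φ n ∂(law f t) = ∑' n, (PowerSeries.coeff n f * t ^ n / eval f t) • φ n := by
  rw [law, integral_sum_dirac fun i => ENNReal.ofReal_ne_top]
  refine tsum_congr fun n => ?_
  have h (n : ℕ) : 0 ≤ PowerSeries.coeff n f * t ^ n := mul_nonneg (hf n) (pow_nonneg ht n)
  rw [ENNReal.toReal_ofReal (div_nonneg (h n) (show 0 ≤ eval f t from tsum_nonneg h))]

theorem integrable_law {f : PowerSeries ℝ} (hf : ∀ n, 0 ≤ PowerSeries.coeff n f) {t : ℝ}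
    (ht : 0 ≤ t) {φ : ℕ → ℝ} (hφ : Summable fun n => PowerSeries.coeff n f * t ^ n * ‖φ n‖) :
    Integrable φ (law f t) := by
  rw [law, integrable_sum_dirac_iff fun i => ENNReal.ofReal_ne_top]
  have h (n : ℕ) : 0 ≤ PowerSeries.coeff n f * t ^ n := mul_nonneg (hf n) (pow_nonneg ht n)
  refine (hφ.div_const (eval f t)).congr fun n => ?_
  rw [ENNReal.toReal_ofReal (div_nonneg (h n) (show 0 ≤ eval f t from tsum_nonneg h))]
  ring

theorem mem_interior_integrableExpSet_normalized {f : PowerSeries ℝ}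
    (hf : ∀ n, 0 ≤ PowerSeries.coeff n f) {t : ℝ} (ht : 0 < t) {u : ℝ}
    (hu : t * Real.exp (u / stdDev f t) ∈ interval f) :
    u ∈ interior (integrableExpSet (normalized f t) (law f t)) := by
  have hopen : IsOpen {v : ℝ | t * Real.exp (v / stdDev f t) ∈ interval f} := by
    have : {v : ℝ | t * Real.exp (v / stdDev f t) ∈ interval f}
        = (fun v => ENNReal.ofReal (t * Real.exp (v / stdDev f t))) ⁻¹' Set.Iio (radius f) := by
      ext v
      have : 0 < t * Real.exp (v / stdDev f t) := by positivity
      simp [interval, this]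
    rw [this]
    exact isOpen_Iio.preimage (ENNReal.continuous_ofReal.comp (by fun_prop))
  refine interior_maximal (fun v hv => ?_) hopen hu
  refine integrable_law hf ht.le ?_
  refine ((summable_of_mem_interval hv).mul_right
    (Real.exp (-(v * mean f t / stdDev f t)))).congr fun n => ?_
  rw [Real.norm_of_nonneg (Real.exp_pos _).le, normalized, mul_pow, ← Real.exp_nat_mul, mul_assoc,
    mul_assoc, mul_assoc, ← Real.exp_add]
  congr 3
  ring

theorem complexMGF_normalized_expSeries {g : PowerSeries ℝ} (hg : IsNonnegSeries g) {t : ℝ}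
    (ht : t ∈ interval g) {z : ℂ}
    (hz : t * Real.exp (z.re / √(powerMoment g 2 t)) ∈ interval g) :
    complexMGF (normalized (expSeries g) t) (law (expSeries g) t) z
      = Complex.exp (evalC g (t * Complex.exp (z / (√(powerMoment g 2 t) : ℝ))) - eval g t
        - z / (√(powerMoment g 2 t) : ℝ) * (powerMoment g 1 t : ℝ)) := by
  have hc := hg.coeff_nonneg
  have hn : ‖(t : ℂ) * Complex.exp (z / (√(powerMoment g 2 t) : ℝ))‖
      = t * Real.exp (z.re / √(powerMoment g 2 t)) := by
    rw [norm_mul, Complex.norm_real, Real.norm_of_nonneg ht.1.le, Complex.norm_exp,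
      Complex.div_ofReal_re]
  have hE := evalC_expSeries hc (w := (t : ℂ) * Complex.exp (z / (√(powerMoment g 2 t) : ℝ)))
    (by rw [hn]; exact hz.2)
  have he : eval (expSeries g) t = Real.exp (eval g t) :=
    eval_expSeries hc (by rw [abs_of_pos ht.1]; exact ht.2)
  rw [complexMGF, integral_law (coeff_expSeries_nonneg hc) ht.1.le, Complex.exp_sub,
    Complex.exp_sub, ← hE, evalC, ← tsum_div_const, ← tsum_div_const]
  refine tsum_congr fun n => ?_
  rw [he, normalized, mean_expSeries hg ht, stdDev_expSeries hg ht, Complex.real_smul, mul_pow,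
    ← Complex.exp_nat_mul]
  have hs : z * (((n - powerMoment g 1 t) / √(powerMoment g 2 t) : ℝ) : ℂ)
      = n * (z / (√(powerMoment g 2 t) : ℝ))
        - z / (√(powerMoment g 2 t) : ℝ) * (powerMoment g 1 t : ℝ) := by
    push_cast
    ring
  rw [hs, Complex.exp_sub]
  push_cast
  ring

/-- The moment generating functions of the normalized variables of `e^g` converge to that of the
standard normal law, uniformly on every disc of the complex plane. -/
theorem tendstoUniformlyOn_complexMGF {g : PowerSeries ℝ} (hg : IsNonnegSeries g)
    (hclan : IsClan g) (hdiv : Tendsto (eval g) (upTo (radius g : EReal)) atTop) {M : ℝ}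
    (hM : 0 < M) :
    (∀ᶠ t in upTo (radius g : EReal), ∀ z ∈ Metric.ball (0 : ℂ) M,
      z.re ∈ interior (integrableExpSet (normalized (expSeries g) t) (law (expSeries g) t))) ∧
    TendstoUniformlyOn
      (fun t => complexMGF (normalized (expSeries g) t) (law (expSeries g) t))
      (complexMGF id (gaussianReal 0 1)) (upTo (radius g : EReal)) (Metric.ball 0 M) := by
  have hsqrt : Tendsto (fun t => √(eval g t)) (upTo (radius g : EReal)) atTop :=
    Real.tendsto_sqrt_atTop.comp hdiv
  have hdom : ∀ᶠ t in upTo (radius g : EReal), t ∈ interval g ∧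
      ∀ z ∈ Metric.ball (0 : ℂ) M,
        t * Real.exp (z.re / √(powerMoment g 2 t)) ∈ interval g ∧
        ‖evalC g (t * Complex.exp (z / (√(powerMoment g 2 t) : ℝ))) - eval g t
          - z / (√(powerMoment g 2 t) : ℝ) * (powerMoment g 1 t : ℝ) - z ^ 2 / 2‖
          ≤ 48 * Real.exp 2 * M ^ 3 / √(eval g t) := by
    filter_upwards [eventually_mem_interval hg.radius_pos,
      eventually_eval_mul_exp_le hg hclan hdiv, hsqrt.eventually_ge_atTop (2 * M)] with t ht htm hA2
    refine ⟨ht, fun z hz => ?_⟩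
    have hzM : ‖z‖ ≤ M := by
      have := Metric.mem_ball.1 hz
      rw [dist_zero_right] at this
      exact this.le
    have hA := eval_pos hg ht
    have hm := mean_pos hg ht
    have hsA : 0 < √(eval g t) := Real.sqrt_pos.2 hA
    have hq : ‖z‖ / √(eval g t) ≤ 1 / 2 := by
      rw [div_le_iff₀ hsA]; linarith
    constructor
    · refine mem_interval_of_le (mul_pos ht.1 (Real.exp_pos _)) ?_ htm.1
      refine mul_le_mul_of_nonneg_left (Real.exp_le_exp.2 ?_) ht.1.le
      calc z.re / √(powerMoment g 2 t) ≤ ‖z‖ / √(powerMoment g 2 t) := by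
            gcongr; exact Complex.re_le_norm z
        _ ≤ _ := norm_div_sqrt_le hg ht z
        _ ≤ 1 * (1 / mean g t) := by gcongr; linarith
        _ = _ := one_mul _
    · refine (norm_evalC_sub_taylor_le hg ht htm.1 hq).trans ?_
      calc 48 * (‖z‖ / √(eval g t)) ^ 3 * eval g (t * Real.exp (1 / mean g t))
          ≤ 48 * (M / √(eval g t)) ^ 3 * (Real.exp 2 * eval g t) := by
            gcongr
            · exact (eval_pos hg htm.1).le
            · exact htm.2
        _ = 48 * (M / √(eval g t)) ^ 3 * (Real.exp 2 * √(eval g t) ^ 2) := by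
            rw [Real.sq_sqrt hA.le]
        _ = _ := by field_simp
  constructor
  · filter_upwards [hdom] with t ht z hz
    refine mem_interior_integrableExpSet_normalized (coeff_expSeries_nonneg hg.coeff_nonneg)
      ht.1.1 ?_
    rw [stdDev_expSeries hg ht.1, interval_expSeries hg.radius_pos hg.coeff_nonneg]
    exact (ht.2 z hz).1
  · rw [Metric.tendstoUniformlyOn_iff]
    intro ε hε
    have h1 : Tendsto (fun t => 48 * Real.exp 2 * M ^ 3 / √(eval g t)) (upTo (radius g : EReal))
        (𝓝 0) := tendsto_const_nhds.div_atTop hsqrt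
    have h2 := h1.const_mul (Real.exp (M ^ 2 / 2) * 2)
    rw [mul_zero] at h2
    filter_upwards [hdom, h1.eventually_le_const one_pos, h2.eventually_lt_const hε]
      with t ht hr1 hr2 z hz
    obtain ⟨hz1, hz2⟩ := ht.2 z hz
    rw [complexMGF_normalized_expSeries hg ht.1 hz1, complexMGF_id_gaussianReal]
    set r : ℂ := evalC g (t * Complex.exp (z / (√(powerMoment g 2 t) : ℝ))) - eval g t
          - z / (√(powerMoment g 2 t) : ℝ) * (powerMoment g 1 t : ℝ) - z ^ 2 / 2 with hr
    have hzM : ‖z‖ ≤ M := by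
      have := Metric.mem_ball.1 hz
      rw [dist_zero_right] at this
      exact this.le
    have hexp : ‖Complex.exp (z ^ 2 / 2)‖ ≤ Real.exp (M ^ 2 / 2) := by
      rw [Complex.norm_exp]
      refine Real.exp_le_exp.2 ((Complex.re_le_norm _).trans ?_)
      rw [norm_div, norm_pow, Complex.norm_two]
      gcongr
    have hsub := sub_add_cancel (evalC g (t * Complex.exp (z / (√(powerMoment g 2 t) : ℝ)))
      - eval g t - z / (√(powerMoment g 2 t) : ℝ) * (powerMoment g 1 t : ℝ)) (z ^ 2 / 2)
    rw [← hsub, ← hr, dist_comm, dist_eq_norm]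
    have hid : Complex.exp (r + z ^ 2 / 2)
        - Complex.exp (z * (0 : ℝ) + ((1 : NNReal) : ℝ) * z ^ 2 / 2)
        = Complex.exp (z ^ 2 / 2) * (Complex.exp r - 1) := by
      rw [Complex.exp_add]
      simp
      ring
    rw [hid, norm_mul]
    calc ‖Complex.exp (z ^ 2 / 2)‖ * ‖Complex.exp r - 1‖
        ≤ Real.exp (M ^ 2 / 2) * (2 * ‖r‖) := by
          gcongr
          exact Complex.norm_exp_sub_one_le (hz2.trans hr1)
      _ ≤ Real.exp (M ^ 2 / 2) * (2 * (48 * Real.exp 2 * M ^ 3 / √(eval g t))) := by gcongr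
      _ = _ := by ring
      _ < ε := hr2

/-! ### Convergence of the moments, Gaussianity, and the iterated exponentials -/

theorem tendstoLocallyUniformlyOn_iteratedDeriv {ι : Type*} {φ : Filter ι} {F : ι → ℂ → ℂ}
    {G : ℂ → ℂ} {U : Set ℂ} (hU : IsOpen U) (h : TendstoLocallyUniformlyOn F G φ U)
    (hF : ∀ᶠ i in φ, DifferentiableOn ℂ (F i) U) (j : ℕ) :
    TendstoLocallyUniformlyOn (fun i => iteratedDeriv j (F i)) (iteratedDeriv j G) φ U ∧
      ∀ᶠ i in φ, DifferentiableOn ℂ (iteratedDeriv j (F i)) U := by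
  induction j with
  | zero => simpa only [iteratedDeriv_zero] using ⟨h, hF⟩
  | succ j ih =>
    simp only [iteratedDeriv_succ]
    exact ⟨ih.1.deriv ih.2 hU, ih.2.mono fun i hi => hi.deriv hU⟩

theorem iteratedDeriv_complexMGF_zero {Ω : Type*} [MeasurableSpace Ω] {μ : Measure Ω} {X : Ω → ℝ}
    (h : (0 : ℝ) ∈ interior (integrableExpSet X μ)) (j : ℕ) :
    iteratedDeriv j (complexMGF X μ) 0 = ((∫ ω, X ω ^ j ∂μ : ℝ) : ℂ) := by
  rw [iteratedDeriv_complexMGF (by simpa using h)]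
  simp only [zero_mul, Complex.exp_zero, mul_one]
  exact_mod_cast integral_ofReal (𝕜 := ℂ) (f := fun ω => X ω ^ j)

theorem integrable_normalized_pow {f : PowerSeries ℝ} (hf : ∀ n, 0 ≤ PowerSeries.coeff n f)
    {t : ℝ} (ht : t ∈ interval f) (j : ℕ) :
    Integrable (fun n : ℕ => normalized f t n ^ j) (law f t) :=
  integrable_pow_of_mem_interior_integrableExpSet
    (mem_interior_integrableExpSet_normalized hf ht.1 (by simpa using ht)) j

theorem tendsto_moment_normalized {g : PowerSeries ℝ} (hg : IsNonnegSeries g)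
    (hclan : IsClan g) (hdiv : Tendsto (eval g) (upTo (radius g : EReal)) atTop) (j : ℕ) :
    Tendsto (fun t : ℝ => ∫ n : ℕ, normalized (expSeries g) t n ^ j ∂(law (expSeries g) t))
      (upTo (radius g : EReal)) (𝓝 (∫ x : ℝ, x ^ j ∂(gaussianReal 0 1))) := by
  obtain ⟨hint, hunif⟩ := tendstoUniformlyOn_complexMGF hg hclan hdiv one_pos
  have hdiff : ∀ᶠ t in upTo (radius g : EReal), DifferentiableOn ℂ
      (complexMGF (normalized (expSeries g) t) (law (expSeries g) t)) (Metric.ball 0 1) :=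
    hint.mono fun t ht => differentiableOn_complexMGF.mono ht
  have h0 : (0 : ℂ) ∈ Metric.ball (0 : ℂ) 1 := Metric.mem_ball_self one_pos
  have hlim := (tendstoLocallyUniformlyOn_iteratedDeriv Metric.isOpen_ball
    hunif.tendstoLocallyUniformlyOn hdiff j).1.tendsto_at h0
  rw [iteratedDeriv_complexMGF_zero (by simp)] at hlim
  refine ((Complex.continuous_re.tendsto _).comp hlim).congr' ?_
  filter_upwards [hint] with t ht
  have h := ht 0 h0
  rw [Complex.zero_re] at h
  rw [Function.comp_apply, iteratedDeriv_complexMGF_zero h, Complex.ofReal_re]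

theorem isGaussian_expSeries {g : PowerSeries ℝ} (hg : IsNonnegSeries g)
    (hclan : IsClan g) (hdiv : Tendsto (eval g) (upTo (radius g : EReal)) atTop) :
    IsGaussian (expSeries g) := by
  refine ⟨inClassK_expSeries hg, ?_⟩
  have hmeas (t : ℝ) : AEMeasurable (normalized (expSeries g) t) (law (expSeries g) t) :=
    measurable_from_nat.aemeasurable
  have (t : interval (expSeries g)) : IsProbabilityMeasure (law (expSeries g) t) :=
    isProbabilityMeasure_law (inClassK_expSeries hg).toIsNonnegSeries t.2
  refine ⟨fun t => hmeas t, aemeasurable_id, ?_⟩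
  rw [radius_expSeries hg.radius_pos hg.coeff_nonneg]
  refine tendsto_of_seq_tendsto fun u hu => ?_
  refine ProbabilityMeasure.tendsto_iff_tendsto_charFun.2 fun θ => ?_
  have hu' : Tendsto (fun n => (u n : ℝ)) atTop (upTo (radius g : EReal)) :=
    tendsto_comap.comp hu
  have hmem : (θ : ℂ) * Complex.I ∈ Metric.ball (0 : ℂ) (|θ| + 1) := by
    simp
  have h := ((tendstoUniformlyOn_complexMGF hg hclan hdiv
    (by positivity : 0 < |θ| + 1)).2.tendsto_at hmem).comp hu'
  rw [complexMGF_id_mul_I] at h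
  simp only [ProbabilityMeasure.coe_mk, Measure.map_id]
  refine h.congr fun n => ?_
  rw [Function.comp_apply, complexMGF_mul_I (hmeas _)]
  rfl

/-- For `f = e^g`, `(σ_f / m_f)² = ((σ_g / m_g)² + 1) / g`, which tends to `0` as `g` tends to
infinity. -/
theorem isClan_expSeries {g : PowerSeries ℝ} (hg : IsNonnegSeries g)
    (hclan : IsClan g) (hdiv : Tendsto (eval g) (upTo (radius g : EReal)) atTop) :
    IsClan (expSeries g) := by
  have hlim : Tendsto (fun t => 2 / √(eval g t)) (upTo (radius g : EReal)) (𝓝 0) :=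
    tendsto_const_nhds.div_atTop (Real.tendsto_sqrt_atTop.comp hdiv)
  rw [IsClan, radius_expSeries hg.radius_pos hg.coeff_nonneg]
  refine squeeze_zero' ?_ ?_ hlim
  · filter_upwards [eventually_mem_interval hg.radius_pos] with t ht
    refine div_nonneg (Real.sqrt_nonneg _) (mean_pos (inClassK_expSeries hg).toIsNonnegSeries ?_).le
    rwa [interval_expSeries hg.radius_pos hg.coeff_nonneg]
  · filter_upwards [eventually_mem_interval hg.radius_pos, hclan.eventually_lt_const one_pos]
      with t ht hlt
    have hA := eval_pos hg ht
    have hm := mean_pos hg ht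
    have hM1 : powerMoment g 1 t = eval g t * mean g t := by
      rw [mean_eq hg.coeff_nonneg ht]
      field_simp
    have hM2 : powerMoment g 2 t ≤ (2 * √(eval g t) * mean g t) ^ 2 := by
      have h1 := stdDev_sq_eq hg.coeff_nonneg ht
      rw [div_lt_one hm] at hlt
      have h2 := pow_le_pow_left₀ (Real.sqrt_nonneg _) hlt.le 2
      rw [← stdDev] at h2
      have h3 : powerMoment g 2 t / eval g t ≤ 2 * mean g t ^ 2 := by linarith
      rw [div_le_iff₀ hA] at h3
      rw [mul_pow, mul_pow, Real.sq_sqrt hA.le]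
      nlinarith [mul_pos hA (pow_pos hm 2)]
    rw [stdDev_expSeries hg ht, mean_expSeries hg ht, hM1]
    have hs : 0 < √(eval g t) := Real.sqrt_pos.2 hA
    rw [div_le_div_iff₀ (mul_pos hA hm) hs]
    calc √(powerMoment g 2 t) * √(eval g t)
        ≤ 2 * √(eval g t) * mean g t * √(eval g t) := by
          gcongr
          exact Real.sqrt_le_iff.2 ⟨by positivity, hM2⟩
      _ = 2 * (√(eval g t) * √(eval g t)) * mean g t := by ring
      _ = 2 * (eval g t * mean g t) := by rw [Real.mul_self_sqrt hA.le, mul_assoc]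

theorem tendsto_eval_expSeries {g : PowerSeries ℝ} (hg : IsNonnegSeries g)
    (hdiv : Tendsto (eval g) (upTo (radius g : EReal)) atTop) :
    Tendsto (eval (expSeries g)) (upTo (radius (expSeries g) : EReal)) atTop := by
  rw [radius_expSeries hg.radius_pos hg.coeff_nonneg]
  refine (Real.tendsto_exp_atTop.comp hdiv).congr' ?_
  filter_upwards [eventually_mem_interval hg.radius_pos] with t ht
  rw [Function.comp_apply, eval_expSeries hg.coeff_nonneg (by rw [abs_of_pos ht.1]; exact ht.2)]

theorem radius_X : radius PowerSeries.X = ⊤ := by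
  refine ENNReal.eq_top_of_forall_nnreal_le fun r => le_radius_of_summable ?_
  refine summable_of_ne_finset_zero (s := {1}) fun n hn => ?_
  rw [PowerSeries.coeff_X, if_neg (by simpa using hn), abs_zero, zero_mul]

theorem powerMoment_X (k : ℕ) (t : ℝ) : powerMoment PowerSeries.X k t = t := by
  rw [powerMoment, tsum_eq_single 1]
  · simp
  · intro n hn
    rw [PowerSeries.coeff_X, if_neg hn, zero_mul, zero_mul]

theorem eval_X (t : ℝ) : eval PowerSeries.X t = t := by
  rw [← powerMoment_zero, powerMoment_X]

theorem isNonnegSeries_X : IsNonnegSeries PowerSeries.X where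
  radius_pos := by rw [radius_X]; exact ENNReal.zero_lt_top
  coeff_nonneg n := by rw [PowerSeries.coeff_X]; split_ifs <;> norm_num
  nonconstant := ⟨1, le_rfl, by simp⟩

theorem isClan_X : IsClan PowerSeries.X := by
  refine tendsto_const_nhds.congr' ?_
  filter_upwards [eventually_mem_interval isNonnegSeries_X.radius_pos] with t ht
  have h := stdDev_sq_eq isNonnegSeries_X.coeff_nonneg ht
  rw [mean_eq isNonnegSeries_X.coeff_nonneg ht, powerMoment_X, powerMoment_X, eval_X,
    div_self ht.1.ne', one_pow, sub_self] at h
  rw [pow_eq_zero_iff two_ne_zero |>.1 h, zero_div]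

theorem tendsto_eval_X :
    Tendsto (eval PowerSeries.X) (upTo (radius PowerSeries.X : EReal)) atTop := by
  refine tendsto_atTop.2 fun b => ?_
  rw [eventually_upTo_iff (bot_lt_coe_ennreal _), radius_X]
  exact ⟨b, EReal.coe_lt_top b, fun t h _ => by rw [eval_X]; exact h.le⟩

/-- The iterates of `g ↦ e^g` starting from `z` are entire clans that tend to infinity. -/
theorem iterate_expSeries_X (k : ℕ) :
    (IsNonnegSeries (expSeries^[k] PowerSeries.X) ∧ IsClan (expSeries^[k] PowerSeries.X) ∧
      Tendsto (eval (expSeries^[k] PowerSeries.X))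
        (upTo (radius (expSeries^[k] PowerSeries.X) : EReal)) atTop) ∧
    radius (expSeries^[k] PowerSeries.X) = ⊤ ∧
      ∀ t : ℝ, eval (expSeries^[k] PowerSeries.X) t = Real.exp^[k] t := by
  induction k with
  | zero => exact ⟨⟨isNonnegSeries_X, isClan_X, tendsto_eval_X⟩, radius_X, eval_X⟩
  | succ k ih =>
    obtain ⟨⟨hg, hclan, hdiv⟩, hR, he⟩ := ih
    rw [Function.iterate_succ_apply']
    refine ⟨⟨(inClassK_expSeries hg).toIsNonnegSeries, isClan_expSeries hg hclan hdiv,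
      tendsto_eval_expSeries hg hdiv⟩, ?_, fun t => ?_⟩
    · rw [radius_expSeries hg.radius_pos hg.coeff_nonneg, hR]
    · rw [eval_expSeries hg.coeff_nonneg (by rw [hR]; exact ENNReal.ofReal_lt_top), he,
        Function.iterate_succ_apply']

end Khinchin

theorem mainTheorem11 :
    (∀ g : PowerSeries ℝ,
      Khinchin.IsNonnegSeries g →
      Khinchin.IsClan g →
      Tendsto (Khinchin.eval g) (Khinchin.upTo (Khinchin.radius g : EReal)) atTop →
      -- the series `f = e^g` has the same radius of convergence as `g` and sum `exp (g t)`
      (Khinchin.radius (Khinchin.expSeries g) = Khinchin.radius g ∧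
        ∀ t : ℝ, ENNReal.ofReal |t| < Khinchin.radius g →
          Khinchin.eval (Khinchin.expSeries g) t = Real.exp (Khinchin.eval g t)) ∧
      -- the quotients of derivatives of the fulcrum tend to zero
      (∀ k : ℕ, 3 ≤ k →
        Tendsto
          (fun s : ℝ => iteratedDeriv k (Khinchin.fulcrum (Khinchin.expSeries g)) s /
            (iteratedDeriv 2 (Khinchin.fulcrum (Khinchin.expSeries g)) s) ^ ((k : ℝ) / 2))
          (Khinchin.upTo (ENNReal.log (Khinchin.radius g))) (𝓝 0)) ∧
      -- the integer moments are finite and converge to the standard normal ones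
      (∀ j : ℕ,
        (∀ t ∈ Khinchin.interval g,
          Integrable (fun n : ℕ => Khinchin.normalized (Khinchin.expSeries g) t n ^ j)
            (Khinchin.law (Khinchin.expSeries g) t)) ∧
        Tendsto
          (fun t : ℝ => ∫ n : ℕ, Khinchin.normalized (Khinchin.expSeries g) t n ^ j
            ∂(Khinchin.law (Khinchin.expSeries g) t))
          (Khinchin.upTo (Khinchin.radius g : EReal))
          (𝓝 (∫ x : ℝ, x ^ j ∂(gaussianReal 0 1)))) ∧
      Khinchin.IsGaussian (Khinchin.expSeries g)) ∧
    -- the iterates `exp ∘ ⋯ ∘ exp` are entire functions with Gaussian power series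
    (∀ k : ℕ, 1 ≤ k →
      (Khinchin.radius (Khinchin.expSeries^[k] PowerSeries.X) = ⊤ ∧
        ∀ t : ℝ, Khinchin.eval (Khinchin.expSeries^[k] PowerSeries.X) t = Real.exp^[k] t) ∧
      Khinchin.IsGaussian (Khinchin.expSeries^[k] PowerSeries.X)) := by
  refine ⟨fun g hg hclan hdiv => ⟨⟨?_, fun t ht => ?_⟩, fun k hk => ?_,
    fun j => ⟨fun t ht => ?_, ?_⟩, ?_⟩, fun k hk => ⟨(Khinchin.iterate_expSeries_X k).2, ?_⟩⟩
  · exact Khinchin.radius_expSeries hg.radius_pos hg.coeff_nonneg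
  · exact Khinchin.eval_expSeries hg.coeff_nonneg ht
  · have hexp := Khinchin.tendsto_exp_upTo (Khinchin.radius g)
    refine ((Khinchin.tendsto_powerMoment_div_rpow hg hclan hdiv hk).comp hexp).congr' ?_
    filter_upwards [hexp.eventually (Khinchin.eventually_mem_interval hg.radius_pos)] with s hs
    rw [Function.comp_apply, Khinchin.iteratedDeriv_fulcrum_expSeries hg.coeff_nonneg k hs,
      Khinchin.iteratedDeriv_fulcrum_expSeries hg.coeff_nonneg 2 hs]
  · refine Khinchin.integrable_normalized_pow (Khinchin.coeff_expSeries_nonneg hg.coeff_nonneg) ?_ j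
    rwa [Khinchin.interval_expSeries hg.radius_pos hg.coeff_nonneg]
  · exact Khinchin.tendsto_moment_normalized hg hclan hdiv j
  · exact Khinchin.isGaussian_expSeries hg hclan hdiv
  · obtain ⟨j, rfl⟩ : ∃ j, k = j + 1 := ⟨k - 1, by omega⟩
    obtain ⟨hg, hclan, hdiv⟩ := (Khinchin.iterate_expSeries_X j).1
    rw [Function.iterate_succ_apply']
    exact Khinchin.isGaussian_expSeries hg hclan hdiv
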